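/- Let $n\ge 3$, let $d=\varphi(n)$, and let $C_n\in \mathrm{GL}_d(\mathbb Z)$ be the companion matrix of the $n$-th cyclotomic polynomial $\Phi_n(x)=a_0+a_1x+\dots+a_{d-1}x^{d-1}+x^d$ (ones on the subdiagonal, last column $-a_0,\dots,-a_{d-1}$, zeros elsewhere). For a skew symmetric real $d\times d$ matrix $\Theta$ put $\omega_\Theta(x,y)=\exp(\pi i\langle \Theta x,y\rangle)$ for $x,y\in\mathbb Z^d$, let $l_\Theta(x)$ be the unitary operator on $\ell^2(\mathbb Z^d)$ given by $(l_\Theta(x)\xi)(y)=\omega_\Theta(x,y-x)\,\xi(y-x)$, and let the noncommutative $d$-torus $\mathcal A_\Theta=C^*(\mathbb Z^d,\omega_\Theta)$ be the $C^*$-algebra of operators on $\ell^2(\mathbb Z^d)$ generated by $\{l_\Theta(x):x\in\mathbb Z^d\}$. Call $\Theta$ nondegenerate if $x=0$ is the only $x\in\mathbb Z^d$ with $\exp(2\pi i\langle x,\Theta y\rangle)=1$ for all $y\in\mathbb Z^d$. Let $G_\Theta=\{A\in \mathrm{GL}_d(\mathbb Z): A^t\Theta A=\Theta\}$. A subgroup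 $G$ of $\mathrm{GL}_d(\mathbb Z)$ is said to act canonically on $\mathcal A_\Theta$ if $G\subset G_\Theta$ and there is an action $\alpha$ of $G$ on $\mathcal A_\Theta$ by $*$-automorphisms such that $\alpha_A(l_\Theta(x))=l_\Theta(Ax)$ for all $A\in G$ and $x\in\mathbb Z^d$. Then $C_n$ has order $n$, so that $\langle C_n\rangle\cong\mathbb Z_n$, and: 1. There is a nondegenerate skew symmetric real $d\times d$ matrix $\Theta$ with $C_n^t\Theta C_n=\Theta$ such that $\mathcal A_\Theta$ is simple (nonzero, with no closed two-sided ideals other than $0$ and $\mathcal A_\Theta$) and $\mathbb Z_n=\langle C_n\rangle$ acts canonically on $\mathcal A_\Theta$. 2. Explicitly, for every irrational $\theta\in\mathbb R$ the matrix $$\Theta=\theta\sum_{k=0}^{n-1}(C_n^k)^t\,(C_n^t-C_n)\,C_n^k$$ is skew symmetric and nondegenerate and satisfies $C_n^t\Theta C_n=\Theta$, the algebra $\mathcal A_\Theta$ is simple, and $\mathbb Z_n=\langle C_n\rangle$ acts canonically on $\mathcal A_\Theta$. -/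

import Mathlib

open scoped Matrix ENNReal

noncomputable section

namespace NCTorus

/-! ### Companion matrices of cyclotomic polynomials -/

/-- The companion matrix of a monic polynomial `p = a₀ + a₁ X + ⋯ + a_{d-1} X ^ (d-1) + X ^ d`:
ones on the subdiagonal, last column `-a₀, …, -a_{d-1}`, zeros elsewhere. -/
def companionMatrix (d : ℕ) (p : Polynomial ℤ) : Matrix (Fin d) (Fin d) ℤ :=
  Matrix.of fun i j =>
    if (j : ℕ) + 1 = d then -p.coeff i else if (i : ℕ) = j + 1 then 1 else 0

theorem companionMatrix_pow_eq_one {d n : ℕ} {p : Polynomial ℤ} (hp : p.Monic)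
    (hd : p.natDegree = d) (hn : p ∣ Polynomial.X ^ n - 1) : companionMatrix d p ^ n = 1 := by
  subst hd
  have key : companionMatrix p.natDegree p =
      Algebra.leftMulMatrix (AdjoinRoot.powerBasis' hp).basis (AdjoinRoot.powerBasis' hp).gen := by
    rw [PowerBasis.leftMulMatrix]
    have h : (AdjoinRoot.powerBasis' hp).minpolyGen = p := by
      have hm := (AdjoinRoot.powerBasis' hp).minpolyGen_monic
      have h0 : AdjoinRoot.mk p (AdjoinRoot.powerBasis' hp).minpolyGen = 0 := by
        rw [← AdjoinRoot.aeval_eq]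
        exact (AdjoinRoot.powerBasis' hp).aeval_minpolyGen
      refine Polynomial.eq_of_monic_of_dvd_of_natDegree_le hp hm (AdjoinRoot.mk_eq_zero.1 h0) ?_
      rw [PowerBasis.natDegree_minpolyGen]
      rfl
    rw [h]
    rfl
  have hroot : (AdjoinRoot.powerBasis' hp).gen ^ n = 1 := by
    have h0 : AdjoinRoot.mk p (Polynomial.X ^ n - 1) = 0 := AdjoinRoot.mk_eq_zero.2 hn
    rw [map_sub, map_pow, map_one, AdjoinRoot.mk_X, sub_eq_zero] at h0
    exact h0
  rw [key]
  exact (map_pow _ _ n).symm.trans ((congrArg _ hroot).trans (map_one _))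

/-- The companion matrix of the `n`-th cyclotomic polynomial, of size `φ(n)`. -/
def cyclotomicMatrix (n : ℕ) : Matrix (Fin n.totient) (Fin n.totient) ℤ :=
  companionMatrix n.totient (Polynomial.cyclotomic n ℤ)

theorem cyclotomicMatrix_pow (n : ℕ) : cyclotomicMatrix n ^ n = 1 :=
  companionMatrix_pow_eq_one (Polynomial.cyclotomic.monic n ℤ)
    (Polynomial.natDegree_cyclotomic n ℤ) (Polynomial.cyclotomic.dvd_X_pow_sub_one n ℤ)

theorem isUnit_det_cyclotomicMatrix (n : ℕ) : IsUnit (cyclotomicMatrix n).det := by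
  rcases Nat.eq_zero_or_pos n with rfl | hn
  · have : IsEmpty (Fin (Nat.totient 0)) := by
      rw [Nat.totient_zero]
      infer_instance
    rw [Matrix.det_isEmpty]
    exact isUnit_one
  · rw [← Matrix.isUnit_iff_isUnit_det]
    exact IsUnit.of_pow_eq_one (cyclotomicMatrix_pow n) hn.ne'

/-- The companion matrix `C_n` of the `n`-th cyclotomic polynomial as an element of
`GL_{φ(n)}(ℤ)`. -/
def cyclotomicGL (n : ℕ) : GL (Fin n.totient) ℤ :=
  Matrix.GeneralLinearGroup.mk'' (cyclotomicMatrix n) (isUnit_det_cyclotomicMatrix n)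

/-! ### Real skew symmetric matrices -/

variable {d : ℕ}

/-- An integer matrix regarded as a real matrix. -/
def toReal (A : Matrix (Fin d) (Fin d) ℤ) : Matrix (Fin d) (Fin d) ℝ :=
  A.map fun a => (a : ℝ)

/-- The skew symmetric real `d × d` matrices. -/
def SkewSymmetric (Θ : Matrix (Fin d) (Fin d) ℝ) : Prop := Θᵀ = -Θ

/-- The pairing `⟨x, Θ y⟩` of integer vectors `x` and `y`. -/
def pairing (Θ : Matrix (Fin d) (Fin d) ℝ) (x y : Fin d → ℤ) : ℝ :=
  (fun i => (x i : ℝ)) ⬝ᵥ (Θ *ᵥ fun i => (y i : ℝ))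

/-- `Θ` is nondegenerate if `x = 0` is the only `x ∈ ℤ^d` such that `exp (2 π i ⟨x, Θ y⟩) = 1` for
all `y ∈ ℤ^d`. -/
def Nondegenerate (Θ : Matrix (Fin d) (Fin d) ℝ) : Prop :=
  ∀ x : Fin d → ℤ,
    (∀ y : Fin d → ℤ, Complex.exp (2 * Real.pi * Complex.I * (pairing Θ x y : ℂ)) = 1) → x = 0

/-- The group `G_Θ` of all `A ∈ GL_d(ℤ)` such that `Aᵀ Θ A = Θ`. -/
def isotropyGroup (Θ : Matrix (Fin d) (Fin d) ℝ) : Subgroup (GL (Fin d) ℤ) where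
  carrier := {A | (toReal A.val)ᵀ * Θ * toReal A.val = Θ}
  one_mem' := by simp [toReal]
  mul_mem' := by
    intro A B hA hB
    have hmul : toReal (A * B).val = toReal A.val * toReal B.val := by
      simp only [toReal, Units.val_mul]
      exact Matrix.map_mul (f := Int.castRingHom ℝ)
    simp only [Set.mem_ofPred_eq] at hA hB ⊢
    calc (toReal (A * B).val)ᵀ * Θ * toReal (A * B).val
        = (toReal B.val)ᵀ * ((toReal A.val)ᵀ * Θ * toReal A.val) * toReal B.val := by
          rw [hmul, Matrix.transpose_mul]
          simp only [Matrix.mul_assoc]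
      _ = Θ := by rw [hA, hB]
  inv_mem' := by
    intro A hA
    have hinv : toReal A.val * toReal (A⁻¹).val = 1 := by
      have h : toReal (A.val * (A⁻¹).val) = toReal A.val * toReal (A⁻¹).val :=
        Matrix.map_mul (f := Int.castRingHom ℝ)
      rw [← h, A.mul_inv]
      simp [toReal]
    simp only [Set.mem_ofPred_eq] at hA ⊢
    calc (toReal (A⁻¹).val)ᵀ * Θ * toReal (A⁻¹).val
        = (toReal (A⁻¹).val)ᵀ * ((toReal A.val)ᵀ * Θ * toReal A.val) * toReal (A⁻¹).val := by
          rw [hA]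
      _ = (toReal A.val * toReal (A⁻¹).val)ᵀ * Θ * (toReal A.val * toReal (A⁻¹).val) := by
          rw [Matrix.transpose_mul]
          simp only [Matrix.mul_assoc]
      _ = Θ := by rw [hinv]; simp

/-! ### The noncommutative torus -/

/-- The Hilbert space `ℓ²(ℤ^d)`. -/
abbrev EllTwo (d : ℕ) : Type := lp (fun _ : Fin d → ℤ => ℂ) 2

/-- The 2-cocycle `ω_Θ(x, y) = exp (π i ⟨Θ x, y⟩)` on `ℤ^d`. -/
def cocycle (Θ : Matrix (Fin d) (Fin d) ℝ) (x y : Fin d → ℤ) : ℂ :=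
  Complex.exp (Real.pi * Complex.I * (pairing Θ y x : ℂ))

theorem norm_cocycle (Θ : Matrix (Fin d) (Fin d) ℝ) (x y : Fin d → ℤ) : ‖cocycle Θ x y‖ = 1 := by
  have h : (Real.pi * Complex.I * (pairing Θ y x : ℂ) : ℂ)
      = ((Real.pi * pairing Θ y x : ℝ) : ℂ) * Complex.I := by
    push_cast
    ring
  rw [cocycle, h, Complex.norm_exp_ofReal_mul_I]

theorem norm_translate (Θ : Matrix (Fin d) (Fin d) ℝ) (x : Fin d → ℤ) (ξ : (Fin d → ℤ) → ℂ)
    (y : Fin d → ℤ) : ‖cocycle Θ x (y - x) * ξ (y - x)‖ = ‖ξ (y - x)‖ := by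
  rw [norm_mul, norm_cocycle, one_mul]

theorem memℓp_translate (Θ : Matrix (Fin d) (Fin d) ℝ) (x : Fin d → ℤ) (ξ : EllTwo d) :
    Memℓp (fun y => cocycle Θ x (y - x) * ξ (y - x)) 2 := by
  have h2 : 0 < (2 : ℝ≥0∞).toReal := by norm_num
  rw [memℓp_gen_iff h2]
  simp only [norm_translate]
  exact (Equiv.subRight x).summable_iff.2 ((memℓp_gen_iff h2).1 (lp.memℓp ξ))

/-- The operator `l_Θ(x)` of the regular `ω_Θ`-representation of `ℤ^d` on `ℓ²(ℤ^d)`: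
`(l_Θ(x) ξ)(y) = ω_Θ(x, y - x) ξ(y - x)`. -/
def regularRep (Θ : Matrix (Fin d) (Fin d) ℝ) (x : Fin d → ℤ) : EllTwo d →L[ℂ] EllTwo d :=
  LinearIsometry.toContinuousLinearMap
    { toFun := fun ξ => ⟨fun y => cocycle Θ x (y - x) * ξ (y - x), memℓp_translate Θ x ξ⟩
      map_add' := fun ξ η => by
        ext y
        exact mul_add _ _ _
      map_smul' := fun c ξ => by
        ext y
        exact mul_left_comm _ _ _
      norm_map' := fun ξ => by
        have h2 : 0 < (2 : ℝ≥0∞).toReal := by norm_num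
        rw [lp.norm_eq_tsum_rpow h2, lp.norm_eq_tsum_rpow h2]
        congr 1
        simp only [LinearMap.coe_mk, AddHom.coe_mk, norm_translate]
        exact (Equiv.subRight x).tsum_eq fun y => ‖ξ y‖ ^ (2 : ℝ≥0∞).toReal }

/-- The noncommutative `d`-torus `A_Θ = C*(ℤ^d, ω_Θ)`, as the C*-algebra of operators on `ℓ²(ℤ^d)`
generated by the operators `l_Θ(x)`, `x ∈ ℤ^d`. -/
def torus (Θ : Matrix (Fin d) (Fin d) ℝ) : StarSubalgebra ℂ (EllTwo d →L[ℂ] EllTwo d) :=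
  (StarAlgebra.adjoin ℂ (Set.range (regularRep Θ))).topologicalClosure

/-- The element `l_Θ(x)` of `A_Θ`. -/
def torusGen (Θ : Matrix (Fin d) (Fin d) ℝ) (x : Fin d → ℤ) : torus Θ :=
  ⟨regularRep Θ x, StarSubalgebra.le_topologicalClosure _
    (StarAlgebra.subset_adjoin ℂ _ (Set.mem_range_self x))⟩

/-- A topological ring is topologically simple if it is nonzero and its only closed two-sided ideals
are zero and the whole ring; this is simplicity for C*-algebras. -/
def TopologicallySimple (A : Type*) [Ring A] [TopologicalSpace A] : Prop :=
  Nontrivial A ∧ ∀ I : TwoSidedIdeal A, IsClosed (I : Set A) → I = ⊥ ∨ I = ⊤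

/-- The subgroup `G` of `GL_d(ℤ)` acts canonically on `A_Θ`: it is contained in `G_Θ`, and it acts
by `*`-automorphisms `α_A` of `A_Θ` such that `α_A(l_Θ(x)) = l_Θ(A x)`. -/
def ActsCanonically (Θ : Matrix (Fin d) (Fin d) ℝ) (G : Subgroup (GL (Fin d) ℤ)) : Prop :=
  G ≤ isotropyGroup Θ ∧
    ∃ α : G →* (torus Θ ≃⋆ₐ[ℂ] torus Θ),
      ∀ (A : G) (x : Fin d → ℤ), α A (torusGen Θ x) = torusGen Θ (A.val.val *ᵥ x)

/-- The matrix `θ ∑_{k=0}^{n-1} (C_n^k)ᵀ (C_nᵀ - C_n) C_n^k`. -/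
def explicitTheta (n : ℕ) (θ : ℝ) : Matrix (Fin n.totient) (Fin n.totient) ℝ :=
  θ • ∑ k ∈ Finset.range n,
    (toReal (cyclotomicMatrix n) ^ k)ᵀ *
      ((toReal (cyclotomicMatrix n))ᵀ - toReal (cyclotomicMatrix n)) *
      toReal (cyclotomicMatrix n) ^ k

end NCTorus

end

/-! Simplicity: conjugation by `l_Θ(y)` multiplies `l_Θ(x)` by `exp (2πi⟨x, Θy⟩)`. For nondegenerate
`Θ` and `x ≠ 0` some `y` makes this scalar different from 1, so Cesàro means of the powers of that
conjugation send `l_Θ(x)` to 0 in the limit while fixing 1. Compositions of such means are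
contractions preserving every two-sided ideal, and they bring any `b` arbitrarily close to `τ(b) •
1`, where `τ` is the canonical trace. A nonzero ideal contains some `b` with `τ(b) ≠ 0`; if closed,
it contains 1 (`eq_top_of_functional_ne_zero`).

Action: `A ∈ G_Θ` preserves the cocycle, so the unitary `ξ ↦ ξ ∘ A⁻¹` conjugates `l_Θ(x)` to
`l_Θ(Ax)`, and all of `G_Θ` acts.

Explicit matrix: write `Θ = θ S`. Averaging over the powers of `C = C_n` makes `S` invariant.
Moreover `S C = P (1 - C²)` (`sum_pow_conj_skew_mul`), where `P = ∑ (C^k)ᵀ C^k` is positive definite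
and `1 - C²` is invertible because `Φ_n` is coprime to `X² - 1` for `n ≥ 3`. So `S` is an invertible
integer matrix, and its irrational multiples are nondegenerate.

The order of `C` is read off from its being multiplication by the class of `X` on `ℤ[X]/(Φ_n)`. -/

open scoped Matrix ENNReal

noncomputable section

namespace NCTorus

variable {d : ℕ}

/-! ### Averaging operators and simplicity -/

section Averaging

variable {A V : Type*} [NormedRing A] [NormedAlgebra ℂ A]

/-- A contractive unital linear map that preserves every two-sided ideal and acts diagonally on the
family `L`. -/
structure IsAveraging (L : V → A) (E : A →ₗ[ℂ] A) : Prop where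
  norm_le : ∀ b, ‖E b‖ ≤ ‖b‖
  map_one : E 1 = 1
  mem_ideal : ∀ (I : TwoSidedIdeal A), ∀ b ∈ I, E b ∈ I
  map_gen : ∀ x, ∃ c : ℂ, ‖c‖ ≤ 1 ∧ E (L x) = c • L x

theorem smul_mem_twoSidedIdeal (I : TwoSidedIdeal A) (c : ℂ) {b : A} (hb : b ∈ I) : c • b ∈ I := by
  rw [Algebra.smul_def]
  exact I.mul_mem_left _ _ hb

namespace IsAveraging

variable {L : V → A} {E F : A →ₗ[ℂ] A}

theorem one : IsAveraging L 1 where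
  norm_le _ := le_rfl
  map_one := rfl
  mem_ideal _ _ hb := hb
  map_gen x := ⟨1, by simp, by simp⟩

theorem mul (hE : IsAveraging L E) (hF : IsAveraging L F) : IsAveraging L (E * F) where
  norm_le b := (hE.norm_le _).trans (hF.norm_le b)
  map_one := by rw [Module.End.mul_apply, hF.map_one, hE.map_one]
  mem_ideal I b hb := hE.mem_ideal I _ (hF.mem_ideal I b hb)
  map_gen x := by
    obtain ⟨c, hc, hcx⟩ := hF.map_gen x
    obtain ⟨c', hc', hcx'⟩ := hE.map_gen x
    refine ⟨c * c', ?_, ?_⟩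
    · rw [norm_mul]
      exact mul_le_one₀ hc (norm_nonneg _) hc'
    · rw [Module.End.mul_apply, hcx, map_smul, hcx', smul_smul]

theorem pow (hE : IsAveraging L E) (k : ℕ) : IsAveraging L (E ^ k) := by
  induction k with
  | zero => exact one
  | succ k ih =>
    rw [pow_succ]
    exact ih.mul hE

end IsAveraging

/-- The mean `(1 + W + ⋯ + W ^ N) / (N + 1)`. -/
def ergodicMean (W : A →ₗ[ℂ] A) (N : ℕ) : A →ₗ[ℂ] A :=
  ((N + 1 : ℕ) : ℂ)⁻¹ • ∑ k ∈ Finset.range (N + 1), W ^ k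

theorem ergodicMean_apply (W : A →ₗ[ℂ] A) (N : ℕ) (b : A) :
    ergodicMean W N b = ((N + 1 : ℕ) : ℂ)⁻¹ • ∑ k ∈ Finset.range (N + 1), (W ^ k) b := by
  simp [ergodicMean, LinearMap.sum_apply]

/-- The target space is arbitrary because the bound serves both for means of elements of the algebra
and for means of eigenvalues in `ℂ`. -/
theorem norm_mean_le {B : Type*} [NormedAddCommGroup B] [NormedSpace ℂ B] (f : ℕ → B) (r : ℝ)
    (hf : ∀ k, ‖f k‖ ≤ r) (N : ℕ) :
    ‖((N + 1 : ℕ) : ℂ)⁻¹ • ∑ k ∈ Finset.range (N + 1), f k‖ ≤ r := by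
  have h0 : (0 : ℝ) < (N + 1 : ℕ) := by positivity
  rw [norm_smul, norm_inv, Complex.norm_natCast, inv_mul_le_iff₀ h0]
  refine (norm_sum_le_of_le _ fun k _ => hf k).trans ?_
  simp

theorem pow_apply_of_eigen {W : A →ₗ[ℂ] A} {a : A} {c : ℂ} (h : W a = c • a) (k : ℕ) :
    (W ^ k) a = c ^ k • a := by
  induction k with
  | zero => simp
  | succ k ih => rw [pow_succ', Module.End.mul_apply, ih, map_smul, h, smul_smul, pow_succ]

theorem IsAveraging.ergodicMean {L : V → A} {W : A →ₗ[ℂ] A} (hW : IsAveraging L W) (N : ℕ) :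
    IsAveraging L (ergodicMean W N) where
  norm_le b := by
    rw [ergodicMean_apply]
    exact norm_mean_le _ _ (fun k => (hW.pow k).norm_le b) N
  map_one := by
    rw [ergodicMean_apply]
    simp only [(hW.pow _).map_one, Finset.sum_const, Finset.card_range]
    rw [← Nat.cast_smul_eq_nsmul ℂ, smul_smul, inv_mul_cancel₀ (Nat.cast_ne_zero.2 N.succ_ne_zero),
      one_smul]
  mem_ideal I b hb := by
    rw [ergodicMean_apply]
    exact smul_mem_twoSidedIdeal I _ (sum_mem fun k _ => (hW.pow k).mem_ideal I b hb)
  map_gen x := by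
    obtain ⟨c, hc, hcx⟩ := hW.map_gen x
    refine ⟨((N + 1 : ℕ) : ℂ)⁻¹ • ∑ k ∈ Finset.range (N + 1), c ^ k,
      norm_mean_le _ _ (fun k => ?_) N, ?_⟩
    · rw [norm_pow]
      exact pow_le_one₀ (norm_nonneg _) hc
    · simp only [ergodicMean_apply, pow_apply_of_eigen hcx, ← Finset.sum_smul, smul_assoc]

/-- On an eigenvector the mean is a geometric sum, bounded by `2 / ‖c - 1‖` before division by `N +
1`. -/
theorem tendsto_ergodicMean_zero {W : A →ₗ[ℂ] A} {a : A} {c : ℂ} (h : W a = c • a) (hc : ‖c‖ ≤ 1)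
    (hc1 : c ≠ 1) : Filter.Tendsto (fun N => ergodicMean W N a) Filter.atTop (nhds 0) := by
  have key : ∀ N, ‖ergodicMean W N a‖ ≤ (2 / ‖c - 1‖ * ‖a‖) * (1 / ((N : ℝ) + 1)) := fun N => by
    rw [ergodicMean_apply]
    simp only [pow_apply_of_eigen h, ← Finset.sum_smul]
    rw [geom_sum_eq hc1, norm_smul, norm_smul, norm_inv, Complex.norm_natCast, norm_div]
    have h2 : ‖c ^ (N + 1) - 1‖ ≤ 2 := by
      refine (norm_sub_le _ _).trans ?_
      rw [norm_pow, norm_one]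
      linarith [pow_le_one₀ (n := N + 1) (norm_nonneg c) hc]
    have h3 : (0 : ℝ) < (N : ℝ) + 1 := by positivity
    push_cast
    rw [one_div, mul_comm]
    gcongr
  refine squeeze_zero_norm key ?_
  simpa using (tendsto_one_div_add_atTop_nhds_zero_nat (𝕜 := ℝ)).const_mul (2 / ‖c - 1‖ * ‖a‖)

/-- Suitable averaging operators approximate the functional `τ`. -/
theorem exists_isAveraging_norm_sub_le {L : V → A} {τ : A →ₗ[ℂ] ℂ}
    (hspan : Dense (Submodule.span ℂ (Set.range L) : Set A))
    (hτ : ∀ b, ‖τ b‖ ≤ ‖b‖) (hone : ‖(1 : A)‖ ≤ 1)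
    (hL : ∀ x, (L x = 1 ∧ τ (L x) = 1) ∨ (τ (L x) = 0 ∧
      ∃ W : A →ₗ[ℂ] A, IsAveraging L W ∧ ∃ c : ℂ, ‖c‖ ≤ 1 ∧ c ≠ 1 ∧ W (L x) = c • L x))
    (b : A) {E : A →ₗ[ℂ] A} (hE : IsAveraging L E) {ε : ℝ} (hε : 0 < ε) :
    ∃ F, IsAveraging L F ∧ ‖F (E b) - τ b • (1 : A)‖ ≤ ε := by
  -- `E` and `ε` are quantified inside the induction: for a sum, the second summand is averaged
  -- after an operator has already been applied for the first.
  have hfin : ∀ b ∈ Submodule.span ℂ (Set.range L), ∀ E, IsAveraging L E → ∀ ε : ℝ, 0 < ε →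
      ∃ F, IsAveraging L F ∧ ‖F (E b) - τ b • (1 : A)‖ ≤ ε := by
    intro b hb
    induction hb using Submodule.span_induction with
    | mem a ha =>
      obtain ⟨x, rfl⟩ := ha
      intro E hE ε hε
      rcases hL x with ⟨h1, h2⟩ | ⟨h0, W, hW, c, hc, hc1, hWx⟩
      · refine ⟨1, .one, ?_⟩
        rw [h2, h1, Module.End.one_apply, hE.map_one, one_smul, sub_self, norm_zero]
        exact hε.le
      · obtain ⟨e, he, hex⟩ := hE.map_gen x
        -- `E` only rescales `L x`, so `E (L x)` is still an eigenvector of `W` with eigenvalue `c`.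
        have hWe : W (E (L x)) = c • E (L x) := by
          rw [hex, map_smul, hWx, smul_comm]
        have ht := (tendsto_ergodicMean_zero hWe hc hc1).norm
        rw [norm_zero] at ht
        obtain ⟨N, hN⟩ := (ht.eventually (gt_mem_nhds hε)).exists
        refine ⟨ergodicMean W N, hW.ergodicMean N, ?_⟩
        rw [h0, zero_smul, sub_zero]
        exact hN.le
    | zero =>
      intro E hE ε hε
      exact ⟨1, .one, by simpa using hε.le⟩
    | add a b _ _ iha ihb =>
      intro E hE ε hε
      obtain ⟨F, hF, hFa⟩ := iha E hE (ε / 2) (half_pos hε)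
      obtain ⟨G, hG, hGb⟩ := ihb (F * E) (hF.mul hE) (ε / 2) (half_pos hε)
      refine ⟨G * F, hG.mul hF, ?_⟩
      -- The later operator `G` fixes scalars and is contractive, so it does not spoil the
      -- approximation reached for `a`.
      have hGa : ‖G (F (E a)) - τ a • (1 : A)‖ ≤ ε / 2 := by
        have h : G (F (E a)) - τ a • (1 : A) = G (F (E a) - τ a • (1 : A)) := by
          rw [map_sub, map_smul, hG.map_one]
        rw [h]
        exact (hG.norm_le _).trans hFa
      have h : (G * F) (E (a + b)) - τ (a + b) • (1 : A) =
          (G (F (E a)) - τ a • (1 : A)) + (G ((F * E) b) - τ b • (1 : A)) := by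
        simp only [Module.End.mul_apply, map_add, add_smul]
        abel
      rw [h]
      exact (norm_add_le _ _).trans (by linarith)
    | smul c a _ iha =>
      intro E hE ε hε
      -- Adding 1 keeps the divisor positive when `c = 0`.
      have hc : 0 < ‖c‖ + 1 := by positivity
      obtain ⟨F, hF, hFa⟩ := iha E hE (ε / (‖c‖ + 1)) (div_pos hε hc)
      refine ⟨F, hF, ?_⟩
      have h : F (E (c • a)) - τ (c • a) • (1 : A) = c • (F (E a) - τ a • (1 : A)) := by
        simp only [map_smul, smul_sub, smul_assoc]
      rw [h, norm_smul]
      calc ‖c‖ * ‖F (E a) - τ a • (1 : A)‖ ≤ (‖c‖ + 1) * (ε / (‖c‖ + 1)) := by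
            gcongr
            linarith
        _ = ε := mul_div_cancel₀ _ hc.ne'
  obtain ⟨p, hp, hpb⟩ := Metric.mem_closure_iff.1 (hspan b) (ε / 3) (by positivity)
  rw [dist_eq_norm] at hpb
  obtain ⟨F, hF, hFp⟩ := hfin p hp E hE (ε / 3) (by positivity)
  refine ⟨F, hF, ?_⟩
  have h : F (E b) - τ b • (1 : A) =
      F (E (b - p)) + (F (E p) - τ p • (1 : A)) - τ (b - p) • (1 : A) := by
    simp only [map_sub, sub_smul]
    abel
  have h1 : ‖F (E (b - p))‖ ≤ ‖b - p‖ := (hF.norm_le _).trans (hE.norm_le _)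
  have h2 : ‖τ (b - p) • (1 : A)‖ ≤ ‖b - p‖ := by
    rw [norm_smul]
    exact (mul_le_of_le_one_right (norm_nonneg _) hone).trans (hτ _)
  rw [h]
  calc _ ≤ _ := norm_sub_le _ _
    _ ≤ ‖F (E (b - p))‖ + ‖F (E p) - τ p • (1 : A)‖ + ‖τ (b - p) • (1 : A)‖ := by
      gcongr
      exact norm_add_le _ _
    _ ≤ ε := by linarith

/-- If averaging operators approximate the functional `τ`, then a closed ideal on which `τ` does not
vanish is the whole algebra. -/
theorem eq_top_of_functional_ne_zero {L : V → A} {τ : A →ₗ[ℂ] ℂ}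
    (hspan : Dense (Submodule.span ℂ (Set.range L) : Set A))
    (hτ : ∀ b, ‖τ b‖ ≤ ‖b‖) (hone : ‖(1 : A)‖ ≤ 1)
    (hL : ∀ x, (L x = 1 ∧ τ (L x) = 1) ∨ (τ (L x) = 0 ∧
      ∃ W : A →ₗ[ℂ] A, IsAveraging L W ∧ ∃ c : ℂ, ‖c‖ ≤ 1 ∧ c ≠ 1 ∧ W (L x) = c • L x))
    {I : TwoSidedIdeal A} (hI : IsClosed (I : Set A)) {b : A} (hb : b ∈ I) (hb0 : τ b ≠ 0) :
    I = ⊤ := by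
  have hmem : τ b • (1 : A) ∈ I := by
    have h : τ b • (1 : A) ∈ closure (I : Set A) := by
      refine Metric.mem_closure_iff.2 fun ε hε => ?_
      obtain ⟨F, hF, hFb⟩ :=
        exists_isAveraging_norm_sub_le hspan hτ hone hL b .one (half_pos hε)
      refine ⟨F b, hF.mem_ideal I b hb, ?_⟩
      rw [dist_comm, dist_eq_norm]
      exact hFb.trans_lt (half_lt_self hε)
    rwa [hI.closure_eq] at h
  have h := smul_mem_twoSidedIdeal I (τ b)⁻¹ hmem
  rw [smul_smul, inv_mul_cancel₀ hb0, one_smul] at h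
  exact I.one_mem_iff.1 h

end Averaging

/-! ### Relations in the noncommutative torus -/

theorem pairing_add_left (Θ : Matrix (Fin d) (Fin d) ℝ) (x y z : Fin d → ℤ) :
    pairing Θ (x + y) z = pairing Θ x z + pairing Θ y z := by
  simp only [pairing, ← add_dotProduct]
  congr 1
  ext i
  simp

theorem pairing_add_right (Θ : Matrix (Fin d) (Fin d) ℝ) (x y z : Fin d → ℤ) :
    pairing Θ x (y + z) = pairing Θ x y + pairing Θ x z := by
  simp only [pairing, ← dotProduct_add, ← Matrix.mulVec_add]
  congr 2
  ext i
  simp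

theorem pairing_neg_right (Θ : Matrix (Fin d) (Fin d) ℝ) (x y : Fin d → ℤ) :
    pairing Θ x (-y) = -pairing Θ x y := by
  simp only [pairing, ← dotProduct_neg, ← Matrix.mulVec_neg]
  congr 2
  ext i
  simp

theorem pairing_zero_left (Θ : Matrix (Fin d) (Fin d) ℝ) (y : Fin d → ℤ) :
    pairing Θ 0 y = 0 := by
  simpa using pairing_add_left Θ 0 0 y

theorem pairing_zero_right (Θ : Matrix (Fin d) (Fin d) ℝ) (x : Fin d → ℤ) :
    pairing Θ x 0 = 0 := by
  simpa using pairing_add_right Θ x 0 0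

theorem pairing_swap {Θ : Matrix (Fin d) (Fin d) ℝ} (hΘ : SkewSymmetric Θ) (x y : Fin d → ℤ) :
    pairing Θ y x = -pairing Θ x y := by
  rw [pairing, pairing, dotProduct_comm, ← Matrix.dotProduct_transpose_mulVec, hΘ,
    Matrix.neg_mulVec, dotProduct_neg,
    neg_neg, dotProduct_comm]

theorem pairing_self {Θ : Matrix (Fin d) (Fin d) ℝ} (hΘ : SkewSymmetric Θ) (x : Fin d → ℤ) :
    pairing Θ x x = 0 := by
  linarith [pairing_swap hΘ x x]

theorem regularRep_apply (Θ : Matrix (Fin d) (Fin d) ℝ) (x : Fin d → ℤ) (ξ : EllTwo d)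
    (y : Fin d → ℤ) : regularRep Θ x ξ y = cocycle Θ x (y - x) * ξ (y - x) :=
  rfl

theorem norm_regularRep_apply (Θ : Matrix (Fin d) (Fin d) ℝ) (x : Fin d → ℤ) (ξ : EllTwo d) :
    ‖regularRep Θ x ξ‖ = ‖ξ‖ := by
  rw [regularRep, LinearIsometry.coe_toContinuousLinearMap, LinearIsometry.norm_map]

theorem norm_regularRep_le (Θ : Matrix (Fin d) (Fin d) ℝ) (x : Fin d → ℤ) :
    ‖regularRep Θ x‖ ≤ 1 :=
  ContinuousLinearMap.opNorm_le_bound _ zero_le_one fun ξ => by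
    rw [norm_regularRep_apply, one_mul]

theorem regularRep_zero (Θ : Matrix (Fin d) (Fin d) ℝ) : regularRep Θ 0 = 1 := by
  ext ξ y
  rw [regularRep_apply, sub_zero, cocycle, pairing_zero_right]
  simp

theorem regularRep_mul (Θ : Matrix (Fin d) (Fin d) ℝ) (x y : Fin d → ℤ) :
    regularRep Θ x * regularRep Θ y = cocycle Θ x y • regularRep Θ (x + y) := by
  ext ξ z
  have h1 : z - x - y = z - (x + y) := sub_sub z x y
  have h2 : z - x = (z - (x + y)) + y := by abel
  change regularRep Θ x (regularRep Θ y ξ) z = cocycle Θ x y * regularRep Θ (x + y) ξ z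
  rw [regularRep_apply, regularRep_apply, regularRep_apply, h1, ← mul_assoc, ← mul_assoc]
  congr 1
  rw [h2]
  simp only [cocycle, ← Complex.exp_add]
  congr 1
  rw [pairing_add_left, pairing_add_right]
  push_cast
  ring

theorem regularRep_mul_neg {Θ : Matrix (Fin d) (Fin d) ℝ} (hΘ : SkewSymmetric Θ)
    (x : Fin d → ℤ) : regularRep Θ x * regularRep Θ (-x) = 1 := by
  rw [regularRep_mul, add_neg_cancel, regularRep_zero, cocycle, pairing_swap hΘ,
    pairing_neg_right, pairing_self hΘ]
  simp

/-- An isometry has its adjoint as left inverse, and `l_Θ(-x)` is a right inverse, so the two agree.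
-/
theorem star_regularRep {Θ : Matrix (Fin d) (Fin d) ℝ} (hΘ : SkewSymmetric Θ) (x : Fin d → ℤ) :
    star (regularRep Θ x) = regularRep Θ (-x) := by
  have h : star (regularRep Θ x) * regularRep Θ x = 1 :=
    (ContinuousLinearMap.norm_map_iff_adjoint_comp_self _).1 (norm_regularRep_apply Θ x)
  exact left_inv_eq_right_inv h (regularRep_mul_neg hΘ x)

/-- By skew symmetry each of the two cocycle factors contributes `πi⟨x, Θy⟩` to the exponent. -/
theorem regularRep_conj {Θ : Matrix (Fin d) (Fin d) ℝ} (hΘ : SkewSymmetric Θ)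
    (x y : Fin d → ℤ) : regularRep Θ y * regularRep Θ x * regularRep Θ (-y) =
      Complex.exp (2 * Real.pi * Complex.I * (pairing Θ x y : ℂ)) • regularRep Θ x := by
  rw [regularRep_mul, smul_mul_assoc, regularRep_mul, smul_smul]
  congr 2
  · simp only [cocycle, ← Complex.exp_add]
    congr 1
    rw [pairing_swap hΘ (y + x), pairing_neg_right, neg_neg, pairing_add_left, pairing_self hΘ]
    push_cast
    ring
  · abel

/-- The linear span of the operators `l_Θ(x)`. -/
abbrev genSpan (Θ : Matrix (Fin d) (Fin d) ℝ) : Submodule ℂ (EllTwo d →L[ℂ] EllTwo d) :=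
  Submodule.span ℂ (Set.range (regularRep Θ))

theorem mul_mem_genSpan {Θ : Matrix (Fin d) (Fin d) ℝ} {a b : EllTwo d →L[ℂ] EllTwo d}
    (ha : a ∈ genSpan Θ) (hb : b ∈ genSpan Θ) : a * b ∈ genSpan Θ := by
  have h : genSpan Θ * genSpan Θ ≤ genSpan Θ := by
    rw [Submodule.span_mul_span, Submodule.span_le]
    rintro _ ⟨_, ⟨x, rfl⟩, _, ⟨y, rfl⟩, rfl⟩
    simp only [regularRep_mul]
    exact Submodule.smul_mem _ _ (Submodule.subset_span ⟨_, rfl⟩)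
  exact h (Submodule.mul_mem_mul ha hb)

theorem star_mem_genSpan {Θ : Matrix (Fin d) (Fin d) ℝ} (hΘ : SkewSymmetric Θ)
    {a : EllTwo d →L[ℂ] EllTwo d} (ha : a ∈ genSpan Θ) : star a ∈ genSpan Θ := by
  induction ha using Submodule.span_induction with
  | mem a ha =>
    obtain ⟨x, rfl⟩ := ha
    rw [star_regularRep hΘ]
    exact Submodule.subset_span ⟨_, rfl⟩
  | zero => simp
  | add a b _ _ iha ihb =>
    rw [star_add]
    exact add_mem iha ihb
  | smul c a _ iha =>
    rw [star_smul]
    exact Submodule.smul_mem _ _ iha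

theorem mem_genSpan_of_mem_adjoin {Θ : Matrix (Fin d) (Fin d) ℝ} (hΘ : SkewSymmetric Θ)
    {a : EllTwo d →L[ℂ] EllTwo d} (ha : a ∈ StarAlgebra.adjoin ℂ (Set.range (regularRep Θ))) :
    a ∈ genSpan Θ := by
  induction ha using StarAlgebra.adjoin_induction with
  | mem a ha => exact Submodule.subset_span ha
  | algebraMap c =>
    rw [Algebra.algebraMap_eq_smul_one, ← regularRep_zero Θ]
    exact Submodule.smul_mem _ _ (Submodule.subset_span ⟨_, rfl⟩)
  | add a b _ _ iha ihb => exact add_mem iha ihb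
  | mul a b _ _ iha ihb => exact mul_mem_genSpan iha ihb
  | star a _ iha => exact star_mem_genSpan hΘ iha

/-- The span of the `l_Θ(x)` is already closed under products and adjoints, hence contains the
generated `*`-algebra, which is dense by definition. -/
theorem dense_span_torusGen {Θ : Matrix (Fin d) (Fin d) ℝ} (hΘ : SkewSymmetric Θ) :
    Dense (Submodule.span ℂ (Set.range (torusGen Θ)) : Set (torus Θ)) := by
  intro b
  rw [Metric.mem_closure_iff]
  intro ε hε
  have hb : (b : EllTwo d →L[ℂ] EllTwo d) ∈
      closure (StarAlgebra.adjoin ℂ (Set.range (regularRep Θ)) : Set _) := b.2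
  obtain ⟨p, hp, hpb⟩ := Metric.mem_closure_iff.1 hb ε hε
  have hmap : genSpan Θ =
      (Submodule.span ℂ (Set.range (torusGen Θ))).map (torus Θ).subtype.toLinearMap := by
    rw [Submodule.map_span, ← Set.range_comp]
    rfl
  have hp' := mem_genSpan_of_mem_adjoin hΘ hp
  rw [hmap] at hp'
  obtain ⟨q, hq, rfl⟩ := hp'
  exact ⟨q, hq, hpb⟩

/-! ### The canonical trace -/

/-- The basis vector `δ_x` of `ℓ²(ℤ^d)`. -/
abbrev deltaVec (x : Fin d → ℤ) : EllTwo d := lp.single 2 x (1 : ℂ)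

theorem norm_deltaVec (x : Fin d → ℤ) : ‖deltaVec x‖ = 1 := by
  rw [lp.norm_single (by norm_num), norm_one]

theorem regularRep_deltaVec_zero (Θ : Matrix (Fin d) (Fin d) ℝ) (x : Fin d → ℤ) :
    regularRep Θ x (deltaVec 0) = deltaVec x := by
  ext y
  rw [regularRep_apply, lp.single_apply, lp.single_apply]
  rcases eq_or_ne y x with rfl | h
  · rw [sub_self, Pi.single_eq_same, Pi.single_eq_same, cocycle, pairing_zero_left]
    simp
  · rw [Pi.single_eq_of_ne h, Pi.single_eq_of_ne (sub_ne_zero.2 h), mul_zero]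

theorem exists_apply_deltaVec_ne_zero {a : EllTwo d →L[ℂ] EllTwo d} (ha : a ≠ 0) :
    ∃ x, a (deltaVec x) ≠ 0 := by
  by_contra! h
  apply ha
  ext1 ξ
  have hs := (lp.hasSum_single (p := 2) (by norm_num) ξ).mapL a
  have h0 : ∀ x, a (lp.single 2 x (ξ x)) = 0 := fun x => by
    have hx : lp.single 2 x (ξ x) = ξ x • deltaVec x := by
      rw [← lp.single_smul, smul_eq_mul, mul_one]
    rw [hx, map_smul, h, smul_zero]
  simp only [h0] at hs
  exact hs.unique hasSum_zero

/-- The canonical trace `τ(a) = ⟨δ_0, a δ_0⟩` on `A_Θ`. -/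
def torusTrace (Θ : Matrix (Fin d) (Fin d) ℝ) : torus Θ →ₗ[ℂ] ℂ where
  toFun a := inner ℂ (deltaVec 0) ((a : EllTwo d →L[ℂ] EllTwo d) (deltaVec 0))
  map_add' _ _ := inner_add_right _ _ _
  map_smul' _ _ := inner_smul_right _ _ _

theorem torusTrace_apply (Θ : Matrix (Fin d) (Fin d) ℝ) (a : torus Θ) :
    torusTrace Θ a = inner ℂ (deltaVec 0) ((a : EllTwo d →L[ℂ] EllTwo d) (deltaVec 0)) :=
  rfl

theorem norm_torusTrace_le (Θ : Matrix (Fin d) (Fin d) ℝ) (a : torus Θ) :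
    ‖torusTrace Θ a‖ ≤ ‖a‖ := by
  have h := (a : EllTwo d →L[ℂ] EllTwo d).le_opNorm (deltaVec 0)
  rw [norm_deltaVec, mul_one] at h
  rw [torusTrace_apply]
  refine (norm_inner_le_norm _ _).trans ?_
  rw [norm_deltaVec, one_mul]
  exact h

theorem torusTrace_torusGen (Θ : Matrix (Fin d) (Fin d) ℝ) (x : Fin d → ℤ) :
    torusTrace Θ (torusGen Θ x) = if x = 0 then 1 else 0 := by
  rw [torusTrace_apply]
  change inner ℂ (deltaVec 0) (regularRep Θ x (deltaVec 0)) = _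
  rw [regularRep_deltaVec_zero, lp.inner_single_left, lp.single_apply]
  split_ifs with h
  · subst h
    simp
  · rw [Pi.single_eq_of_ne (Ne.symm h), inner_zero_right]

theorem torusTrace_star_mul_self (Θ : Matrix (Fin d) (Fin d) ℝ) (a : torus Θ) :
    torusTrace Θ (star a * a) =
      (‖(a : EllTwo d →L[ℂ] EllTwo d) (deltaVec 0)‖ : ℂ) ^ 2 := by
  rw [torusTrace_apply]
  change inner ℂ (deltaVec 0) (ContinuousLinearMap.adjoint (a : EllTwo d →L[ℂ] EllTwo d)
    ((a : EllTwo d →L[ℂ] EllTwo d) (deltaVec 0))) = _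
  rw [ContinuousLinearMap.adjoint_inner_right]
  exact inner_self_eq_norm_sq_to_K _

theorem torusGen_zero (Θ : Matrix (Fin d) (Fin d) ℝ) : torusGen Θ 0 = 1 :=
  Subtype.ext (regularRep_zero Θ)

theorem norm_torusGen_le (Θ : Matrix (Fin d) (Fin d) ℝ) (x : Fin d → ℤ) : ‖torusGen Θ x‖ ≤ 1 :=
  norm_regularRep_le Θ x

/-! ### Simplicity -/

/-- Conjugation by `l_Θ(y)`. -/
def torusConj (Θ : Matrix (Fin d) (Fin d) ℝ) (y : Fin d → ℤ) : torus Θ →ₗ[ℂ] torus Θ :=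
  LinearMap.mulLeftRight ℂ (torusGen Θ y, torusGen Θ (-y))

theorem torusConj_apply (Θ : Matrix (Fin d) (Fin d) ℝ) (y : Fin d → ℤ) (b : torus Θ) :
    torusConj Θ y b = torusGen Θ y * b * torusGen Θ (-y) := by
  simp [torusConj]

theorem torusConj_torusGen {Θ : Matrix (Fin d) (Fin d) ℝ} (hΘ : SkewSymmetric Θ)
    (x y : Fin d → ℤ) : torusConj Θ y (torusGen Θ x) =
      Complex.exp (2 * Real.pi * Complex.I * (pairing Θ x y : ℂ)) • torusGen Θ x := by
  rw [torusConj_apply]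
  exact Subtype.ext (regularRep_conj hΘ x y)

theorem norm_exp_two_pi_I_mul (t : ℝ) :
    ‖Complex.exp (2 * Real.pi * Complex.I * (t : ℂ))‖ = 1 := by
  have h : (2 * Real.pi * Complex.I * (t : ℂ) : ℂ) = ((2 * Real.pi * t : ℝ) : ℂ) * Complex.I := by
    push_cast
    ring
  rw [h, Complex.norm_exp_ofReal_mul_I]

theorem isAveraging_torusConj {Θ : Matrix (Fin d) (Fin d) ℝ} (hΘ : SkewSymmetric Θ)
    (y : Fin d → ℤ) : IsAveraging (torusGen Θ) (torusConj Θ y) where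
  norm_le b := by
    rw [torusConj_apply]
    calc ‖torusGen Θ y * b * torusGen Θ (-y)‖
        ≤ ‖torusGen Θ y‖ * ‖b‖ * ‖torusGen Θ (-y)‖ := norm_mul₃_le
      _ ≤ 1 * ‖b‖ * 1 := by
        gcongr
        · exact norm_torusGen_le Θ y
        · exact norm_torusGen_le Θ (-y)
      _ = ‖b‖ := by ring
  map_one := by
    rw [torusConj_apply, mul_one]
    exact Subtype.ext (regularRep_mul_neg hΘ y)
  mem_ideal I b hb := by
    rw [torusConj_apply]
    exact I.mul_mem_right _ _ (I.mul_mem_left _ _ hb)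
  map_gen x := ⟨_, (norm_exp_two_pi_I_mul _).le, torusConj_torusGen hΘ x y⟩

/-- The noncommutative torus of a nondegenerate skew symmetric matrix is simple. -/
theorem topologicallySimple_torus {Θ : Matrix (Fin d) (Fin d) ℝ} (hΘ : SkewSymmetric Θ)
    (hnd : Nondegenerate Θ) : TopologicallySimple (torus Θ) := by
  refine ⟨⟨0, 1, fun h => ?_⟩, fun I hI => ?_⟩
  · have h1 := torusTrace_torusGen Θ 0
    rw [torusGen_zero, ← h, map_zero, if_pos rfl] at h1
    exact zero_ne_one h1
  · refine or_iff_not_imp_left.2 fun hbot => ?_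
    obtain ⟨a, haI, ha⟩ : ∃ a ∈ I, a ≠ 0 := by
      by_contra! h
      exact hbot (le_bot_iff.1 fun a haI => (TwoSidedIdeal.mem_bot _).2 (h a haI))
    obtain ⟨x, hx⟩ := exists_apply_deltaVec_ne_zero (fun h => ha (Subtype.ext h))
    -- Since `l_Θ(x)` carries `δ_0` to `δ_x`, the trace of this element is `‖a δ_x‖² ≠ 0`.
    have hmem : star (a * torusGen Θ x) * (a * torusGen Θ x) ∈ I :=
      I.mul_mem_left _ _ (I.mul_mem_right _ _ haI)
    refine eq_top_of_functional_ne_zero (dense_span_torusGen hΘ) (norm_torusTrace_le Θ)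
      (torusGen_zero Θ ▸ norm_torusGen_le Θ 0) (fun y => ?_) hI hmem ?_
    · rcases eq_or_ne y 0 with rfl | hy
      · exact .inl ⟨torusGen_zero Θ, by rw [torusTrace_torusGen, if_pos rfl]⟩
      · refine .inr ⟨by rw [torusTrace_torusGen, if_neg hy], ?_⟩
        obtain ⟨z, hz⟩ : ∃ z, Complex.exp (2 * Real.pi * Complex.I * (pairing Θ y z : ℂ)) ≠ 1 := by
          by_contra! h
          exact hy (hnd y h)
        exact ⟨torusConj Θ z, isAveraging_torusConj hΘ z, _, (norm_exp_two_pi_I_mul _).le, hz,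
          torusConj_torusGen hΘ y z⟩
    · rw [torusTrace_star_mul_self]
      have h : ((a * torusGen Θ x : torus Θ) : EllTwo d →L[ℂ] EllTwo d) (deltaVec 0) =
          (a : EllTwo d →L[ℂ] EllTwo d) (deltaVec x) :=
        congrArg (a : EllTwo d →L[ℂ] EllTwo d) (regularRep_deltaVec_zero Θ x)
      rw [h]
      exact pow_ne_zero 2 (Complex.ofReal_ne_zero.2 (norm_ne_zero_iff.2 hx))

/-! ### Canonical actions -/

theorem memℓp_comp_equiv {ι : Type*} (e : ι ≃ ι) (ξ : lp (fun _ : ι => ℂ) 2) :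
    Memℓp (fun y => ξ (e y)) 2 := by
  have h2 : 0 < (2 : ℝ≥0∞).toReal := by norm_num
  rw [memℓp_gen_iff h2]
  exact e.summable_iff.2 ((memℓp_gen_iff h2).1 (lp.memℓp ξ))

/-- The unitary on `ℓ²(ι)` that permutes the coordinates. -/
def permuteIsometry {ι : Type*} (e : ι ≃ ι) :
    lp (fun _ : ι => ℂ) 2 ≃ₗᵢ[ℂ] lp (fun _ : ι => ℂ) 2 where
  toFun ξ := ⟨fun y => ξ (e y), memℓp_comp_equiv e ξ⟩
  invFun ξ := ⟨fun y => ξ (e.symm y), memℓp_comp_equiv e.symm ξ⟩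
  left_inv ξ := by
    ext y
    exact congrArg ξ (e.apply_symm_apply y)
  right_inv ξ := by
    ext y
    exact congrArg ξ (e.symm_apply_apply y)
  map_add' ξ η := rfl
  map_smul' c ξ := rfl
  norm_map' ξ := by
    have h2 : 0 < (2 : ℝ≥0∞).toReal := by norm_num
    rw [lp.norm_eq_tsum_rpow h2, lp.norm_eq_tsum_rpow h2]
    congr 1
    exact e.tsum_eq fun y => ‖ξ y‖ ^ (2 : ℝ≥0∞).toReal

/-- The permutation `y ↦ A⁻¹ y` of `ℤ^d`. -/
def invMulVecEquiv (A : GL (Fin d) ℤ) : (Fin d → ℤ) ≃ (Fin d → ℤ) where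
  toFun y := (A⁻¹).val *ᵥ y
  invFun y := A.val *ᵥ y
  left_inv y := by simp only [Matrix.mulVec_mulVec, Units.mul_inv, Matrix.one_mulVec]
  right_inv y := by simp only [Matrix.mulVec_mulVec, Units.inv_mul, Matrix.one_mulVec]

/-- The unitary representation of `GL_d(ℤ)` on `ℓ²(ℤ^d)`. -/
def permuteHom (d : ℕ) : GL (Fin d) ℤ →* (EllTwo d ≃ₗᵢ[ℂ] EllTwo d) where
  toFun A := permuteIsometry (invMulVecEquiv A)
  map_one' := by
    ext ξ y
    change ξ (((1 : GL (Fin d) ℤ)⁻¹).val *ᵥ y) = ξ y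
    rw [inv_one, Units.val_one, Matrix.one_mulVec]
  map_mul' A B := by
    ext ξ y
    change ξ ((A * B)⁻¹.val *ᵥ y) = ξ ((B⁻¹).val *ᵥ ((A⁻¹).val *ᵥ y))
    rw [mul_inv_rev, Units.val_mul, Matrix.mulVec_mulVec]

theorem permuteHom_apply (A : GL (Fin d) ℤ) (ξ : EllTwo d) (y : Fin d → ℤ) :
    permuteHom d A ξ y = ξ ((A⁻¹).val *ᵥ y) :=
  rfl

/-- The action of `GL_d(ℤ)` on the bounded operators on `ℓ²(ℤ^d)` by conjugation. -/
def conjHom (d : ℕ) :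
    GL (Fin d) ℤ →* ((EllTwo d →L[ℂ] EllTwo d) ≃⋆ₐ[ℂ] (EllTwo d →L[ℂ] EllTwo d)) :=
  (Unitary.conjStarAlgAut ℂ (EllTwo d →L[ℂ] EllTwo d)).comp
    (Unitary.linearIsometryEquiv.symm.toMonoidHom.comp (permuteHom d))

theorem conjHom_apply_apply (A : GL (Fin d) ℤ) (a : EllTwo d →L[ℂ] EllTwo d) (ξ : EllTwo d) :
    conjHom d A a ξ = permuteHom d A (a ((permuteHom d A).symm ξ)) := by
  rw [conjHom, MonoidHom.comp_apply, MonoidHom.comp_apply, MulEquiv.coe_toMonoidHom,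
    Unitary.conjStarAlgAut_symm_unitaryLinearIsometryEquiv]
  rfl

theorem continuous_conjHom (A : GL (Fin d) ℤ) : Continuous (conjHom d A) := by
  change Continuous fun a => (Unitary.linearIsometryEquiv.symm (permuteHom d A) :
    EllTwo d →L[ℂ] EllTwo d) * a * (star (Unitary.linearIsometryEquiv.symm (permuteHom d A)) :
      unitary (EllTwo d →L[ℂ] EllTwo d))
  fun_prop

theorem pairing_mulVec {Θ : Matrix (Fin d) (Fin d) ℝ} {A : GL (Fin d) ℤ}
    (hA : A ∈ isotropyGroup Θ) (x y : Fin d → ℤ) :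
    pairing Θ (A.val *ᵥ x) (A.val *ᵥ y) = pairing Θ x y := by
  have hA' : (toReal A.val)ᵀ * Θ * toReal A.val = Θ := hA
  have hcast : ∀ z : Fin d → ℤ,
      (fun i => ((A.val *ᵥ z) i : ℝ)) = toReal A.val *ᵥ fun i => (z i : ℝ) := fun z => by
    ext i
    simp [Matrix.mulVec, dotProduct, toReal]
  rw [pairing, hcast, hcast, pairing]
  conv_rhs => rw [← hA']
  rw [← Matrix.vecMul_transpose, ← Matrix.dotProduct_mulVec, Matrix.mulVec_mulVec,
    Matrix.mulVec_mulVec, Matrix.mul_assoc]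

theorem conjHom_regularRep {Θ : Matrix (Fin d) (Fin d) ℝ} {A : GL (Fin d) ℤ}
    (hA : A ∈ isotropyGroup Θ) (x : Fin d → ℤ) :
    conjHom d A (regularRep Θ x) = regularRep Θ (A.val *ᵥ x) := by
  ext ξ y
  rw [conjHom_apply_apply, permuteHom_apply, regularRep_apply, regularRep_apply]
  have hy : A.val *ᵥ ((A⁻¹).val *ᵥ y - x) = y - A.val *ᵥ x := by
    rw [Matrix.mulVec_sub, Matrix.mulVec_mulVec, Units.mul_inv, Matrix.one_mulVec]
  congr 1
  · rw [← hy, cocycle, cocycle, pairing_mulVec hA]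
  · exact congrArg ξ hy

/-- Conjugation permutes the generators and is continuous, so the preimage of `A_Θ` is a closed
`*`-subalgebra containing them. -/
theorem conjHom_mem_torus {Θ : Matrix (Fin d) (Fin d) ℝ} {A : GL (Fin d) ℤ}
    (hA : A ∈ isotropyGroup Θ) {a : EllTwo d →L[ℂ] EllTwo d} (ha : a ∈ torus Θ) :
    conjHom d A a ∈ torus Θ := by
  have h : torus Θ ≤ (torus Θ).comap (conjHom d A : _ →⋆ₐ[ℂ] _) := by
    refine StarSubalgebra.topologicalClosure_minimal (StarAlgebra.adjoin_le ?_) ?_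
    · rintro _ ⟨x, rfl⟩
      change conjHom d A (regularRep Θ x) ∈ torus Θ
      rw [conjHom_regularRep hA]
      exact (torusGen Θ _).2
    · exact (StarSubalgebra.isClosed_topologicalClosure _).preimage (continuous_conjHom A)
  exact h ha

/-- The canonical action of `G_Θ` on `A_Θ`. -/
def canonicalAction (Θ : Matrix (Fin d) (Fin d) ℝ) :
    isotropyGroup Θ →* (torus Θ ≃⋆ₐ[ℂ] torus Θ) where
  toFun A :=
    { toFun := fun a => ⟨conjHom d A a, conjHom_mem_torus A.2 a.2⟩
      invFun := fun a => ⟨conjHom d (A⁻¹ : isotropyGroup Θ) a, conjHom_mem_torus (A⁻¹).2 a.2⟩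
      left_inv := fun a => Subtype.ext <| by
        change (conjHom d (A : GL (Fin d) ℤ)⁻¹ * conjHom d A) (a : EllTwo d →L[ℂ] EllTwo d) = a
        rw [← map_mul, inv_mul_cancel, map_one]
        rfl
      right_inv := fun a => Subtype.ext <| by
        change (conjHom d A * conjHom d (A : GL (Fin d) ℤ)⁻¹) (a : EllTwo d →L[ℂ] EllTwo d) = a
        rw [← map_mul, mul_inv_cancel, map_one]
        rfl
      map_mul' := fun a b => Subtype.ext (map_mul (conjHom d A) _ _)
      map_add' := fun a b => Subtype.ext (map_add (conjHom d A) _ _)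
      map_star' := fun a => Subtype.ext (map_star (conjHom d A) _)
      map_smul' := fun c a => Subtype.ext (map_smul (conjHom d A) c _) }
  map_one' := by
    ext1 a
    refine Subtype.ext ?_
    change conjHom d 1 (a : EllTwo d →L[ℂ] EllTwo d) = a
    rw [map_one]
    rfl
  map_mul' A B := by
    ext1 a
    refine Subtype.ext ?_
    change conjHom d (A * B : GL (Fin d) ℤ) (a : EllTwo d →L[ℂ] EllTwo d) =
      conjHom d A (conjHom d B a)
    rw [map_mul]
    rfl

theorem actsCanonically_of_le {Θ : Matrix (Fin d) (Fin d) ℝ} {G : Subgroup (GL (Fin d) ℤ)}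
    (hG : G ≤ isotropyGroup Θ) : ActsCanonically Θ G :=
  ⟨hG, (canonicalAction Θ).comp (Subgroup.inclusion hG), fun A x =>
    Subtype.ext (conjHom_regularRep (hG A.2) x)⟩

/-! ### Powers of the companion matrix -/

/-- The companion matrix expresses multiplication by the class of `X` on `ℤ[X]/(p)` in the basis of
powers. -/
theorem companionMatrix_eq_leftMulMatrix {p : Polynomial ℤ} (hp : p.Monic) :
    companionMatrix p.natDegree p = Algebra.leftMulMatrix (AdjoinRoot.powerBasis' hp).basis
      (AdjoinRoot.powerBasis' hp).gen := by
  have h : (AdjoinRoot.powerBasis' hp).minpolyGen = p := by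
    have hm := (AdjoinRoot.powerBasis' hp).minpolyGen_monic
    have h0 : AdjoinRoot.mk p (AdjoinRoot.powerBasis' hp).minpolyGen = 0 := by
      rw [← AdjoinRoot.aeval_eq]
      exact (AdjoinRoot.powerBasis' hp).aeval_minpolyGen
    refine Polynomial.eq_of_monic_of_dvd_of_natDegree_le hp hm (AdjoinRoot.mk_eq_zero.1 h0) ?_
    rw [PowerBasis.natDegree_minpolyGen]
    rfl
  rw [PowerBasis.leftMulMatrix, h]
  rfl

/-- The regular representation of `ℤ[X]/(p)` is faithful, so `q` kills the matrix exactly when it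
vanishes in the quotient. -/
theorem aeval_companionMatrix_eq_zero_iff {d : ℕ} {p : Polynomial ℤ} (hp : p.Monic)
    (hd : p.natDegree = d) (q : Polynomial ℤ) :
    Polynomial.aeval (companionMatrix d p) q = 0 ↔ p ∣ q := by
  subst hd
  have h := Polynomial.aeval_algHom_apply
    (Algebra.leftMulMatrix (AdjoinRoot.powerBasis' hp).basis) (AdjoinRoot.powerBasis' hp).gen q
  rw [companionMatrix_eq_leftMulMatrix hp, ← AdjoinRoot.mk_eq_zero, ← AdjoinRoot.aeval_eq]
  refine Iff.trans ?_ (map_eq_zero_iff (Algebra.leftMulMatrix (AdjoinRoot.powerBasis' hp).basis)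
    (Algebra.leftMulMatrix_injective _))
  exact Eq.congr_left h

theorem orderOf_cyclotomicGL {n : ℕ} (hn : 0 < n) : orderOf (cyclotomicGL n) = n := by
  have hpow : ∀ m : ℕ, cyclotomicGL n ^ m = 1 ↔ n ∣ m := fun m => by
    have hval : (cyclotomicGL n ^ m).val = cyclotomicMatrix n ^ m := by
      rw [Units.val_pow_eq_pow_val]
      rfl
    rw [Units.ext_iff, hval, Units.val_one]
    have h := aeval_companionMatrix_eq_zero_iff (Polynomial.cyclotomic.monic n ℤ)
      (Polynomial.natDegree_cyclotomic n ℤ) (Polynomial.X ^ m - 1)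
    rw [map_sub, map_pow, Polynomial.aeval_X, map_one, sub_eq_zero] at h
    refine h.trans ⟨fun hdvd => ?_, fun hdvd => ?_⟩
    · have hζ := Complex.isPrimitiveRoot_exp n hn.ne'
      obtain ⟨q, hq⟩ := hdvd
      have hr := hζ.isRoot_cyclotomic hn
      have hev := congrArg (Polynomial.aeval (Complex.exp (2 * Real.pi * Complex.I / n))) hq
      have hr' : Polynomial.aeval (Complex.exp (2 * Real.pi * Complex.I / n))
          (Polynomial.cyclotomic n ℤ) = 0 := by
        rw [Polynomial.aeval_def, Polynomial.eval₂_eq_eval_map, Polynomial.map_cyclotomic]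
        exact hr
      rw [map_mul, hr', zero_mul, map_sub, map_pow, Polynomial.aeval_X, map_one,
        sub_eq_zero] at hev
      exact hζ.dvd_of_pow_eq_one m hev
    · exact (Polynomial.cyclotomic.dvd_X_pow_sub_one n ℤ).trans
        (by obtain ⟨k, rfl⟩ := hdvd
            rw [pow_mul]
            simpa using sub_one_dvd_pow_sub_one ((Polynomial.X : Polynomial ℤ) ^ n) k)
  refine Nat.dvd_antisymm (orderOf_dvd_of_pow_eq_one ((hpow n).2 dvd_rfl)) ?_
  exact (hpow _).1 (pow_orderOf_eq_one _)

/-! ### The explicit matrix -/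

theorem toReal_mul {d : ℕ} (A B : Matrix (Fin d) (Fin d) ℤ) :
    toReal (A * B) = toReal A * toReal B :=
  Matrix.map_mul (f := Int.castRingHom ℝ)

theorem toReal_one {d : ℕ} : toReal (1 : Matrix (Fin d) (Fin d) ℤ) = 1 := by
  simp [toReal]

theorem toReal_pow {d : ℕ} (A : Matrix (Fin d) (Fin d) ℤ) (k : ℕ) :
    toReal (A ^ k) = toReal A ^ k := by
  induction k with
  | zero => simp [toReal_one]
  | succ k ih => rw [pow_succ, toReal_mul, ih, pow_succ]

theorem toReal_cyclotomicMatrix_pow (n : ℕ) : toReal (cyclotomicMatrix n) ^ n = 1 := by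
  rw [← toReal_pow, cyclotomicMatrix_pow, toReal_one]

theorem isUnit_aeval_of_isCoprime {A : Type*} [Ring A] [Algebra ℚ A] {a : A}
    {p q : Polynomial ℚ} (h : IsCoprime p q) (hp : Polynomial.aeval a p = 0) :
    IsUnit (Polynomial.aeval a q) := by
  obtain ⟨u, v, huv⟩ := h
  have h1 := congrArg (Polynomial.aeval a) huv
  rw [map_add, map_mul, map_mul, hp, mul_zero, zero_add, map_one] at h1
  refine ⟨⟨_, Polynomial.aeval a v, ?_, h1⟩, rfl⟩
  rw [← map_mul, mul_comm, map_mul, h1]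

/-- `X² - 1 = Φ_1 Φ_2`, and both factors are coprime to `Φ_n` since `n ≥ 3`. The Bézout identities
need rational coefficients: over `ℤ` they can fail, as `Φ_n(1)` may be a prime. -/
theorem isUnit_sq_sub_one {n : ℕ} (hn : 3 ≤ n) :
    IsUnit (toReal (cyclotomicMatrix n) ^ 2 - 1) := by
  set C := toReal (cyclotomicMatrix n) with hC
  have h0 : Polynomial.aeval C (Polynomial.cyclotomic n ℚ) = 0 := by
    have h := (aeval_companionMatrix_eq_zero_iff (Polynomial.cyclotomic.monic n ℤ)
      (Polynomial.natDegree_cyclotomic n ℤ) (Polynomial.cyclotomic n ℤ)).2 dvd_rfl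
    have h' := congrArg ((Int.castRingHom ℝ).mapMatrix.toIntAlgHom) h
    rw [map_zero, ← Polynomial.aeval_algHom_apply] at h'
    rw [← Polynomial.map_cyclotomic_int, ← algebraMap_int_eq, Polynomial.aeval_map_algebraMap]
    exact h'
  have h1 := isUnit_aeval_of_isCoprime (Polynomial.cyclotomic.isCoprime_rat (m := 1)
    (by omega)) h0
  have h2 := isUnit_aeval_of_isCoprime (Polynomial.cyclotomic.isCoprime_rat (m := 2)
    (by omega)) h0
  rw [Polynomial.cyclotomic_one, map_sub, Polynomial.aeval_X, map_one] at h1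
  rw [Polynomial.cyclotomic_two, map_add, Polynomial.aeval_X, map_one] at h2
  have h : C ^ 2 - 1 = (C - 1) * (C + 1) := by noncomm_ring
  rw [h]
  exact h1.mul h2

section InvariantForm

variable {ι R : Type*} [Fintype ι] [DecidableEq ι] [CommRing R]

theorem transpose_sum_pow_conj_skew (C : Matrix ι ι R) (n : ℕ) :
    (∑ k ∈ Finset.range n, (C ^ k)ᵀ * (Cᵀ - C) * C ^ k)ᵀ =
      -∑ k ∈ Finset.range n, (C ^ k)ᵀ * (Cᵀ - C) * C ^ k := by
  rw [Matrix.transpose_sum, ← Finset.sum_neg_distrib]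
  refine Finset.sum_congr rfl fun k _ => ?_
  rw [Matrix.transpose_mul, Matrix.transpose_mul, Matrix.transpose_transpose,
    Matrix.transpose_sub, Matrix.transpose_transpose, ← neg_sub Cᵀ C]
  simp only [Matrix.mul_neg, Matrix.neg_mul, Matrix.mul_assoc]

/-- Conjugation by `C` shifts the summation index by one, and the terms `k = 0` and `k = n`
coincide. -/
theorem transpose_mul_sum_pow_conj_mul {C : Matrix ι ι R} {n : ℕ} (hC : C ^ n = 1)
    (B : Matrix ι ι R) :
    Cᵀ * (∑ k ∈ Finset.range n, (C ^ k)ᵀ * B * C ^ k) * C =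
      ∑ k ∈ Finset.range n, (C ^ k)ᵀ * B * C ^ k := by
  have h : ∀ k, Cᵀ * ((C ^ k)ᵀ * B * C ^ k) * C = (C ^ (k + 1))ᵀ * B * C ^ (k + 1) := fun k => by
    rw [pow_succ, Matrix.transpose_mul]
    simp only [Matrix.mul_assoc]
  rw [Matrix.mul_sum, Matrix.sum_mul]
  simp only [h]
  have h1 := Finset.sum_range_succ (fun k => (C ^ k)ᵀ * B * C ^ k) n
  rw [Finset.sum_range_succ' (fun k => (C ^ k)ᵀ * B * C ^ k) n, hC, pow_zero] at h1
  exact add_right_cancel h1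

/-- Multiplied by `C`, the averaged skew form factors through the averaged inner product. -/
theorem sum_pow_conj_skew_mul {C : Matrix ι ι R} {n : ℕ} (hC : C ^ n = 1) :
    (∑ k ∈ Finset.range n, (C ^ k)ᵀ * (Cᵀ - C) * C ^ k) * C =
      (∑ k ∈ Finset.range n, (C ^ k)ᵀ * C ^ k) * (1 - C ^ 2) := by
  -- With `B = 1` this is the invariance of the averaged inner product, which absorbs the factors
  -- `Cᵀ` and `C` of the first half of each term.
  have h := transpose_mul_sum_pow_conj_mul hC (1 : Matrix ι ι R)
  simp only [Matrix.mul_one] at h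
  have hterm : ∀ k, (C ^ k)ᵀ * (Cᵀ - C) * C ^ k * C =
      Cᵀ * ((C ^ k)ᵀ * C ^ k) * C - (C ^ k)ᵀ * C ^ k * C ^ 2 := fun k => by
    have h1 : (C ^ k)ᵀ * Cᵀ = Cᵀ * (C ^ k)ᵀ := by
      rw [← Matrix.transpose_mul, ← Matrix.transpose_mul, ← pow_succ, ← pow_succ']
    have h2 : C * C ^ k = C ^ k * C := (pow_succ' C k).symm.trans (pow_succ C k)
    rw [Matrix.mul_sub, h1, pow_two]
    simp only [Matrix.sub_mul, Matrix.mul_assoc]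
    congr 2
    rw [← Matrix.mul_assoc, h2, Matrix.mul_assoc]
  rw [Matrix.sum_mul]
  simp only [hterm]
  rw [Finset.sum_sub_distrib, ← Matrix.sum_mul, ← Matrix.mul_sum, h, ← Matrix.sum_mul,
    Matrix.mul_sub, Matrix.mul_one]

end InvariantForm

/-- The term `k = 0` is the identity, which is positive definite, and the remaining terms are
positive semidefinite. -/
theorem isUnit_sum_transpose_pow_mul_pow {ι : Type*} [Fintype ι] [DecidableEq ι]
    (C : Matrix ι ι ℝ) {n : ℕ} (hn : 0 < n) :
    IsUnit (∑ k ∈ Finset.range n, (C ^ k)ᵀ * C ^ k) := by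
  obtain ⟨m, rfl⟩ := Nat.exists_eq_add_one_of_ne_zero hn.ne'
  rw [Finset.sum_range_succ', pow_zero, Matrix.transpose_one, Matrix.mul_one]
  refine Matrix.PosDef.isUnit (Matrix.PosDef.posSemidef_add ?_ Matrix.PosDef.one)
  refine Matrix.posSemidef_sum _ fun k _ => ?_
  rw [← Matrix.conjTranspose_eq_transpose_of_trivial]
  exact Matrix.posSemidef_conjTranspose_mul_self _

theorem isUnit_sum_pow_conj_skew {n : ℕ} (hn : 3 ≤ n) :
    IsUnit (∑ k ∈ Finset.range n, (toReal (cyclotomicMatrix n) ^ k)ᵀ *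
      ((toReal (cyclotomicMatrix n))ᵀ - toReal (cyclotomicMatrix n)) *
      toReal (cyclotomicMatrix n) ^ k) := by
  have hC := toReal_cyclotomicMatrix_pow n
  have hU : IsUnit (toReal (cyclotomicMatrix n)) := IsUnit.of_pow_eq_one hC (by omega)
  rw [← hU.mul_right_iff, sum_pow_conj_skew_mul hC]
  refine (isUnit_sum_transpose_pow_mul_pow _ (by omega)).mul ?_
  rw [← neg_sub]
  exact (isUnit_sq_sub_one hn).neg

theorem skewSymmetric_explicitTheta (n : ℕ) (θ : ℝ) : SkewSymmetric (explicitTheta n θ) := by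
  rw [SkewSymmetric, explicitTheta, Matrix.transpose_smul, transpose_sum_pow_conj_skew, smul_neg]

theorem explicitTheta_invariant (n : ℕ) (θ : ℝ) :
    (toReal (cyclotomicMatrix n))ᵀ * explicitTheta n θ * toReal (cyclotomicMatrix n) =
      explicitTheta n θ := by
  rw [explicitTheta, Matrix.mul_smul, Matrix.smul_mul,
    transpose_mul_sum_pow_conj_mul (toReal_cyclotomicMatrix_pow n)]

/-- An irrational multiple of an invertible integer matrix is nondegenerate. -/
theorem nondegenerate_smul_toReal {d : ℕ} {θ : ℝ} (hθ : Irrational θ)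
    {M : Matrix (Fin d) (Fin d) ℤ} (hM : IsUnit (toReal M)) : Nondegenerate (θ • toReal M) := by
  intro x hx
  have hint : ∀ y : Fin d → ℤ, pairing (θ • toReal M) x y = θ * ((x ⬝ᵥ M *ᵥ y : ℤ) : ℝ) := by
    intro y
    simp only [pairing, Matrix.smul_mulVec, dotProduct_smul, smul_eq_mul, toReal]
    congr 1
    simp [dotProduct, Matrix.mulVec]
  have hzero : ∀ y : Fin d → ℤ, x ⬝ᵥ M *ᵥ y = 0 := fun y => by
    by_contra h0
    obtain ⟨k, hk⟩ := Complex.exp_eq_one_iff.1 (hx y)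
    have h2 : (2 * Real.pi * Complex.I : ℂ) ≠ 0 := Complex.two_pi_I_ne_zero
    rw [mul_comm (k : ℂ)] at hk
    -- The pairing is an integer `k`, yet it is `θ` times a nonzero integer, which is irrational.
    have h3 := mul_left_cancel₀ h2 hk
    have h4 : pairing (θ • toReal M) x y = (k : ℝ) := by exact_mod_cast h3
    rw [hint] at h4
    exact (hθ.mul_intCast h0).ne_int k h4
  have hvec : x ᵥ* M = 0 := by
    refine dotProduct_eq_zero _ fun y => ?_
    rw [← Matrix.dotProduct_mulVec]
    exact hzero y
  have hreal : (fun i => (x i : ℝ)) ᵥ* toReal M = 0 := by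
    ext j
    have h := congrArg (Int.cast : ℤ → ℝ) (congrFun hvec j)
    simpa [Matrix.vecMul, dotProduct, toReal] using h
  have h := Matrix.vecMul_injective_of_isUnit hM (hreal.trans (Matrix.zero_vecMul _).symm)
  ext i
  exact Int.cast_eq_zero.1 (congrFun h i)

theorem nondegenerate_explicitTheta {n : ℕ} (hn : 3 ≤ n) {θ : ℝ} (hθ : Irrational θ) :
    Nondegenerate (explicitTheta n θ) := by
  have h : toReal (∑ k ∈ Finset.range n, (cyclotomicMatrix n ^ k)ᵀ *
      ((cyclotomicMatrix n)ᵀ - cyclotomicMatrix n) * cyclotomicMatrix n ^ k) =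
      ∑ k ∈ Finset.range n, (toReal (cyclotomicMatrix n) ^ k)ᵀ *
      ((toReal (cyclotomicMatrix n))ᵀ - toReal (cyclotomicMatrix n)) *
      toReal (cyclotomicMatrix n) ^ k := by
    have hs := map_sum (Int.castRingHom ℝ).mapMatrix (fun k => (cyclotomicMatrix n ^ k)ᵀ *
      ((cyclotomicMatrix n)ᵀ - cyclotomicMatrix n) * cyclotomicMatrix n ^ k) (Finset.range n)
    refine hs.trans (Finset.sum_congr rfl fun k _ => ?_)
    rw [map_mul, map_mul, map_sub, map_pow, ← toReal_pow]
    congr 2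
    exact (map_pow (Int.castRingHom ℝ).mapMatrix _ k).symm
  rw [explicitTheta, ← h]
  exact nondegenerate_smul_toReal hθ (h ▸ isUnit_sum_pow_conj_skew hn)

theorem explicitTheta_properties {n : ℕ} (hn : 3 ≤ n) {θ : ℝ} (hθ : Irrational θ) :
    SkewSymmetric (explicitTheta n θ) ∧ Nondegenerate (explicitTheta n θ) ∧
      (toReal (cyclotomicMatrix n))ᵀ * explicitTheta n θ * toReal (cyclotomicMatrix n) =
        explicitTheta n θ ∧
      TopologicallySimple (torus (explicitTheta n θ)) ∧
      ActsCanonically (explicitTheta n θ) (Subgroup.zpowers (cyclotomicGL n)) := by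
  have hskew := skewSymmetric_explicitTheta n θ
  have hnd := nondegenerate_explicitTheta hn hθ
  have hinv := explicitTheta_invariant n θ
  exact ⟨hskew, hnd, hinv, topologicallySimple_torus hskew hnd,
    actsCanonically_of_le (Subgroup.zpowers_le.2 hinv)⟩

end NCTorus

end

theorem mainTheorem2 (n : ℕ) (hn : 3 ≤ n) :
    orderOf (NCTorus.cyclotomicGL n) = n ∧
    (∃ Θ : Matrix (Fin n.totient) (Fin n.totient) ℝ,
      NCTorus.SkewSymmetric Θ ∧ NCTorus.Nondegenerate Θ ∧
      (NCTorus.toReal (NCTorus.cyclotomicMatrix n))ᵀ * Θ *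
        NCTorus.toReal (NCTorus.cyclotomicMatrix n) = Θ ∧
      NCTorus.TopologicallySimple (NCTorus.torus Θ) ∧
      NCTorus.ActsCanonically Θ (Subgroup.zpowers (NCTorus.cyclotomicGL n))) ∧
    (∀ θ : ℝ, Irrational θ →
      NCTorus.SkewSymmetric (NCTorus.explicitTheta n θ) ∧
      NCTorus.Nondegenerate (NCTorus.explicitTheta n θ) ∧
      (NCTorus.toReal (NCTorus.cyclotomicMatrix n))ᵀ * NCTorus.explicitTheta n θ *
        NCTorus.toReal (NCTorus.cyclotomicMatrix n) = NCTorus.explicitTheta n θ ∧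
      NCTorus.TopologicallySimple (NCTorus.torus (NCTorus.explicitTheta n θ)) ∧
      NCTorus.ActsCanonically (NCTorus.explicitTheta n θ)
        (Subgroup.zpowers (NCTorus.cyclotomicGL n))) := by
  refine ⟨NCTorus.orderOf_cyclotomicGL (by omega),
    ⟨NCTorus.explicitTheta n (√2), NCTorus.explicitTheta_properties hn irrational_sqrt_two⟩,
    fun θ hθ => NCTorus.explicitTheta_properties hn hθ⟩
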